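/- Let $(X,d)$ be a Hadamard space, that is, a complete CAT(0) space. For $x,y\in X$ and $0\le t\le 1$, write $ty+(1-t)x$ for the unique point $p$ on the geodesic segment from $x$ to $y$ with $d(x,p)=t\,d(x,y)$. Let $\bar x\in X$. For a finite set $I$ and points $p_i\in X$ $(i\in I)$, a vector $w\in\mathbb{R}^I$ *certifies* $\bar x\in\mathrm{mean}(\{p_i : i\in I\})$ if $w_i\ge 0$ for all $i$, $\sum_{i} w_i=1$, and $\bar x$ minimizes $x\mapsto\sum_{i}w_i\,d(x,p_i)^2$ over $X$. A finite set is regarded as a family indexed by itself. A point $x\in X$ *certifies* $\bar x\notin\mathrm{mean}(B)$, for a finite set $B\subset X$, if $d(x,b)<d(\bar x,b)$ for all $b\in B$. **Theorem (Certifying means from contractions).** Let $A\subset X$ be finite with $\bar x\notin A$. For each $a\in A$ let $0<t_a\le 1$, and let $$A'=\{\,t_a a+(1-t_a)\bar x : a\in A\,\},$$ considered as a family indexed by $A$ when weights are attached to its points. 1. If a vector $w\in\mathbb{R}^A$ certifies $\bar x\in\mathrm{mean}(A')$, then the vector with components $\dfrac{t_a w_a}{\sum_{b\in A}t_b w_b}$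 $(a\in A)$ certifies $\bar x\in\mathrm{mean}(A)$. 2. If a point $x\in X$ certifies $\bar x\notin\mathrm{mean}(A')$, then for all sufficiently small $s>0$ the point $s x+(1-s)\bar x$ certifies $\bar x\notin\mathrm{mean}(A)$. -/

import Mathlib

open Set Filter Topology

/-- `S` is a geodesic segment joining `x` to `y`: the image of the compact interval
`[0, dist x y]` under an isometry that starts at `x` and ends at `y`. -/
def IsGeodesicSegment {X : Type*} [MetricSpace X] (x y : X) (S : Set X) : Prop :=
  ∃ γ : ℝ → X, γ 0 = x ∧ γ (dist x y) = y ∧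
    (∀ s ∈ Icc 0 (dist x y), ∀ t ∈ Icc 0 (dist x y), dist (γ s) (γ t) = |s - t|) ∧
    S = γ '' Icc 0 (dist x y)

/-- A CAT(0) space: a geodesic metric space in which, in every geodesic triangle, distances
between points on its sides are no larger than the distances between the corresponding points of
a comparison triangle in the Euclidean plane.

The triangle has vertices `v 0, v 1, v 2` and sides `S i` joining `v i` to `v (i + 1)` (indices
modulo 3), and the comparison triangle has vertices `c 0, c 1, c 2`. The comparison point of
`p ∈ S i` is the point of the segment from `c i` to `c (i + 1)` whose distance from `c i` is
`dist (v i) p`. -/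
class IsCAT0Space (X : Type*) [MetricSpace X] : Prop where
  exists_segment : ∀ x y : X, ∃ S : Set X, IsGeodesicSegment x y S
  dist_le_comparison : ∀ (v : Fin 3 → X) (S : Fin 3 → Set X) (c : Fin 3 → EuclideanSpace ℝ (Fin 2)),
    (∀ i, IsGeodesicSegment (v i) (v (i + 1)) (S i)) →
    (∀ i j, dist (c i) (c j) = dist (v i) (v j)) →
    ∀ i j, ∀ p ∈ S i, ∀ q ∈ S j,
      ∀ p' ∈ segment ℝ (c i) (c (i + 1)), ∀ q' ∈ segment ℝ (c j) (c (j + 1)),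
        dist (c i) p' = dist (v i) p → dist (c j) q' = dist (v j) q →
          dist p q ≤ dist p' q'

/-- A Hadamard space: a complete CAT(0) space. -/
class IsHadamardSpace (X : Type*) [MetricSpace X] : Prop extends IsCAT0Space X, CompleteSpace X

/-- `p` divides the way from `x` to `y` in the ratio `t : 1 - t`. -/
def IsGeodesicPoint {X : Type*} [MetricSpace X] (x y : X) (t : ℝ) (p : X) : Prop :=
  dist x p = t * dist x y ∧ dist p y = (1 - t) * dist x y

open Classical in
/-- The point `t y + (1 - t) x` of the geodesic segment from `x` to `y`, for `0 ≤ t ≤ 1`. In a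
CAT(0) space it exists and is unique, see `isGeodesicPoint_geodesicPoint` and
`IsGeodesicPoint.eq_geodesicPoint`. (Junk value `x` where there is no such point.) -/
noncomputable def geodesicPoint {X : Type*} [MetricSpace X] (x y : X) (t : ℝ) : X :=
  if h : ∃ p, IsGeodesicPoint x y t p then h.choose else x

theorem IsGeodesicSegment.exists_isGeodesicPoint {X : Type*} [MetricSpace X] {x y : X} {S : Set X}
    (hS : IsGeodesicSegment x y S) {t : ℝ} (h0 : 0 ≤ t) (h1 : t ≤ 1) :
    ∃ p ∈ S, IsGeodesicPoint x y t p := by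
  obtain ⟨γ, hx, hy, hγ, rfl⟩ := hS
  have hd : 0 ≤ dist x y := dist_nonneg
  have ht : t * dist x y ∈ Icc 0 (dist x y) :=
    ⟨mul_nonneg h0 hd, mul_le_of_le_one_left hd h1⟩
  refine ⟨_, mem_image_of_mem γ ht, ?_, ?_⟩
  · have := hγ 0 ⟨le_rfl, hd⟩ _ ht
    rwa [hx, zero_sub, abs_neg, abs_of_nonneg ht.1] at this
  · have := hγ _ ht (dist x y) ⟨hd, le_rfl⟩
    rw [hy, abs_sub_comm, abs_of_nonneg (sub_nonneg.2 ht.2)] at this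
    rw [this]; ring

theorem isGeodesicPoint_geodesicPoint {X : Type*} [MetricSpace X] [IsCAT0Space X] (x y : X) {t : ℝ}
    (h0 : 0 ≤ t) (h1 : t ≤ 1) : IsGeodesicPoint x y t (geodesicPoint x y t) := by
  obtain ⟨S, hS⟩ := IsCAT0Space.exists_segment x y
  obtain ⟨p, -, hp⟩ := hS.exists_isGeodesicPoint h0 h1
  have h : ∃ p, IsGeodesicPoint x y t p := ⟨p, hp⟩
  rw [geodesicPoint, dif_pos h]
  exact h.choose_spec

theorem IsGeodesicPoint.eq_of_mem_segment {X : Type*} [MetricSpace X] [IsCAT0Space X] {x y p q : X}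
    {S : Set X} {t : ℝ} (h0 : 0 ≤ t) (h1 : t ≤ 1) (hS : IsGeodesicSegment x y S) (hpS : p ∈ S)
    (hp : IsGeodesicPoint x y t p) (hq : IsGeodesicPoint x y t q) : p = q := by
  obtain ⟨S₁, hS₁⟩ := IsCAT0Space.exists_segment y q
  obtain ⟨S₂, hS₂⟩ := IsCAT0Space.exists_segment q x
  have hd : 0 ≤ dist x y := dist_nonneg
  have hqS : q ∈ S₂ := by
    obtain ⟨γ, hγ, -, -, rfl⟩ := hS₂
    exact ⟨0, ⟨le_rfl, dist_nonneg⟩, hγ⟩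
  let e : EuclideanSpace ℝ (Fin 2) := EuclideanSpace.single 0 1
  have he : ‖e‖ = 1 := by simp [e]
  have key : ∀ r s : ℝ, dist (r • e) (s • e) = |r - s| := fun r s => by
    rw [dist_eq_norm, ← sub_smul, norm_smul, he, mul_one, Real.norm_eq_abs]
  have e1 : |(1 : ℝ) - t| = 1 - t := abs_of_nonneg (sub_nonneg.2 h1)
  have hc : ∀ i j, dist (![(0 : ℝ) • e, dist x y • e, (t * dist x y) • e] i)
      (![(0 : ℝ) • e, dist x y • e, (t * dist x y) • e] j) = dist (![x, y, q] i) (![x, y, q] j) := by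
    have a1 : |0 - dist x y| = dist x y := by rw [zero_sub, abs_neg, abs_of_nonneg hd]
    have a2 : |0 - t * dist x y| = dist x q := by
      rw [zero_sub, abs_neg, abs_of_nonneg (mul_nonneg h0 hd), hq.1]
    have a3 : |dist x y - t * dist x y| = dist q y := by
      rw [hq.2, abs_of_nonneg] <;> nlinarith
    intro i j
    fin_cases i <;> fin_cases j <;> simp only [Fin.zero_eta, Fin.mk_one, Fin.reduceFinMk,
      Matrix.cons_val, key] <;> first
      | simp only [sub_self, abs_zero, dist_self]
      | (first | exact a1 | exact a2 | exact a3
               | (rw [abs_sub_comm]; first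
                  | exact a1.trans (dist_comm _ _) | exact a2.trans (dist_comm _ _)
                  | exact a3)
               | exact a3.trans (dist_comm _ _))
  have := IsCAT0Space.dist_le_comparison ![x, y, q] ![S, S₁, S₂]
    ![(0 : ℝ) • e, dist x y • e, (t * dist x y) • e]
    (by intro i; fin_cases i <;> assumption) hc 0 2 p hpS q hqS
    ((t * dist x y) • e) ⟨1 - t, t, sub_nonneg.2 h1, h0, by ring, by simp [mul_smul]⟩
    ((t * dist x y) • e) (left_mem_segment ℝ _ _)
    (by
      change dist ((0 : ℝ) • e) _ = dist x p
      rw [key, hp.1, zero_sub, abs_neg, abs_of_nonneg (mul_nonneg h0 hd)])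
    (by
      change dist ((t * dist x y) • e) _ = dist q q
      simp)
  rw [dist_self] at this
  exact dist_le_zero.1 this

theorem IsGeodesicPoint.eq_geodesicPoint {X : Type*} [MetricSpace X] [IsCAT0Space X] {x y q : X}
    {t : ℝ} (h0 : 0 ≤ t) (h1 : t ≤ 1) (hq : IsGeodesicPoint x y t q) :
    q = geodesicPoint x y t := by
  obtain ⟨S, hS⟩ := IsCAT0Space.exists_segment x y
  obtain ⟨p, hpS, hp⟩ := hS.exists_isGeodesicPoint h0 h1
  rw [← hp.eq_of_mem_segment h0 h1 hS hpS hq]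
  exact hp.eq_of_mem_segment h0 h1 hS hpS (isGeodesicPoint_geodesicPoint x y h0 h1)

/-- The weight vector `w` certifies that `xbar` lies in the mean set of the finite family
`(pt i)`: `w` lies in the simplex and `xbar` minimizes `x ↦ ∑ i, w i * dist x (pt i) ^ 2` over the
whole space. For a finite set `A`, take the family `fun a : A => (a : X)`. -/
def CertifiesMemMean {X : Type*} [MetricSpace X] {ι : Type*} [Fintype ι] (pt : ι → X) (xbar : X)
    (w : ι → ℝ) : Prop :=
  w ∈ stdSimplex ℝ ι ∧
    ∀ x : X, ∑ i, w i * dist xbar (pt i) ^ 2 ≤ ∑ i, w i * dist x (pt i) ^ 2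

/-- The point `x` certifies that `xbar` does not lie in the mean set of the set `A`: it is strictly
closer than `xbar` to every point of `A`. -/
def CertifiesNotMemMean {X : Type*} [MetricSpace X] (A : Set X) (xbar x : X) : Prop :=
  ∀ a ∈ A, dist x a < dist xbar a

/-! Both parts rest on the strong convexity of squared distance, `dist_geodesicPoint_sq_le`. Write T
= ∑ t_i w_i and F(z) = ∑ t_i w_i d(z, p_i)². Minimality of xbar for the contracted points, combined
with strong convexity along each geodesic from xbar to p_i, gives F(xbar) ≤ F(z) + (1 - T) d(xbar,
z)². The error is of second order in d(xbar, z), while F is convex along geodesics; so moving z to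
xbar along the geodesic from x and dividing by the parameter removes it. This is
`CertifiesMemMean.sum_mul_dist_sq_le`, and normalizing by T > 0 gives part 1. For part 2, the
triangle inequality through the contracted point shows that x is already closer than xbar to each
point of A, and convexity carries this to the geodesic from xbar to x. -/

/-- The Euclidean distance in the plane, in coordinates. -/
theorem dist_toLp_fin_two (a b c d : ℝ) :
    dist (!₂[a, b] : EuclideanSpace ℝ (Fin 2)) !₂[c, d] = √((a - c) ^ 2 + (b - d) ^ 2) := by
  simp [EuclideanSpace.dist_eq, Fin.sum_univ_two, Real.dist_eq, sq_abs]

/-- A CAT(0) space satisfies the Bruhat–Tits inequality: the squared distance to a point is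
`2`-strongly convex along geodesics. -/
theorem dist_geodesicPoint_sq_le {X : Type*} [MetricSpace X] [IsCAT0Space X] (x y z : X) {t : ℝ}
    (h0 : 0 ≤ t) (h1 : t ≤ 1) :
    dist (geodesicPoint x y t) z ^ 2 ≤
      (1 - t) * dist x z ^ 2 + t * dist y z ^ 2 - t * (1 - t) * dist x y ^ 2 := by
  have hg := isGeodesicPoint_geodesicPoint x y h0 h1
  rcases eq_or_ne x y with rfl | hxy
  · have : x = geodesicPoint x x t := by
      apply dist_eq_zero.1
      simpa using hg.1
    rw [← this, dist_self]
    exact le_of_eq (by ring)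
  obtain ⟨S, hS⟩ := IsCAT0Space.exists_segment x y
  obtain ⟨S₁, hS₁⟩ := IsCAT0Space.exists_segment y z
  obtain ⟨S₂, hS₂⟩ := IsCAT0Space.exists_segment z x
  obtain ⟨p, hpS, hp⟩ := hS.exists_isGeodesicPoint h0 h1
  rw [← hp.eq_geodesicPoint h0 h1]
  have hzS : z ∈ S₂ := by
    obtain ⟨γ, hγ, -, -, rfl⟩ := hS₂
    exact ⟨0, ⟨le_rfl, dist_nonneg⟩, hγ⟩
  have hd : 0 < dist x y := dist_pos.2 hxy
  have tri₁ := dist_triangle x y z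
  have tri₂ := dist_triangle_left x y z
  have tri₃ := dist_triangle y x z
  rw [dist_comm z x, dist_comm z y] at tri₂
  rw [dist_comm y x] at tri₃
  have hD : 0 ≤ dist x z := dist_nonneg
  have he : 0 ≤ dist y z := dist_nonneg
  have hpx := hp.1
  generalize hdd : dist x y = d at *
  generalize hDD : dist x z = D at *
  generalize hee : dist y z = e at *
  -- By the law of cosines, u is the first coordinate of the comparison point of z when x lies at
  -- the origin and y at (d, 0). The triangle inequalities give |u| ≤ D, so the second coordinate v
  -- is real.
  obtain ⟨u, hu⟩ : ∃ u, 2 * d * u = d ^ 2 + D ^ 2 - e ^ 2 :=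
    ⟨(d ^ 2 + D ^ 2 - e ^ 2) / (2 * d), by field_simp⟩
  have hu₁ : u ≤ D := le_of_mul_le_mul_left (by nlinarith) (by linarith : 0 < 2 * d)
  have hu₂ : -D ≤ u := le_of_mul_le_mul_left (by nlinarith) (by linarith : 0 < 2 * d)
  have hv : √(D ^ 2 - u ^ 2) ^ 2 = D ^ 2 - u ^ 2 := Real.sq_sqrt (by nlinarith)
  generalize √(D ^ 2 - u ^ 2) = v at hv
  let c : Fin 3 → EuclideanSpace ℝ (Fin 2) := ![!₂[0, 0], !₂[d, 0], !₂[u, v]]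
  have c₁ : dist (c 0) (c 1) = dist x y := by
    rw [hdd]
    refine (dist_toLp_fin_two ..).trans ((Real.sqrt_eq_iff_mul_self_eq (by positivity) hd.le).2 ?_)
    ring
  have c₂ : dist (c 0) (c 2) = dist x z := by
    rw [hDD]
    refine (dist_toLp_fin_two ..).trans ((Real.sqrt_eq_iff_mul_self_eq (by positivity) hD).2 ?_)
    linear_combination hv
  have c₃ : dist (c 1) (c 2) = dist y z := by
    rw [hee]
    refine (dist_toLp_fin_two ..).trans ((Real.sqrt_eq_iff_mul_self_eq (by positivity) he).2 ?_)
    linear_combination hv - hu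
  have hc : ∀ i j, dist (c i) (c j) = dist (![x, y, z] i) (![x, y, z] j) := by
    intro i j
    fin_cases i <;> fin_cases j
    · exact (dist_self _).trans (dist_self _).symm
    · exact c₁
    · exact c₂
    · exact (dist_comm _ _).trans (c₁.trans (dist_comm _ _))
    · exact (dist_self _).trans (dist_self _).symm
    · exact c₃
    · exact (dist_comm _ _).trans (c₂.trans (dist_comm _ _))
    · exact (dist_comm _ _).trans (c₃.trans (dist_comm _ _))
    · exact (dist_self _).trans (dist_self _).symm
  -- Side 2 starts at z, so z serves as its own point on that side, with comparison point the vertex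
  -- (u, v).
  have key := IsCAT0Space.dist_le_comparison ![x, y, z] ![S, S₁, S₂] c
    (by intro i; fin_cases i <;> assumption) hc 0 2 p hpS z hzS
    !₂[t * d, 0] ⟨1 - t, t, sub_nonneg.2 h1, h0, by ring, by
      ext i; fin_cases i <;> simp [c]⟩
    !₂[u, v] (left_mem_segment ℝ _ _)
    (by
      change dist (!₂[0, 0] : EuclideanSpace ℝ (Fin 2)) _ = dist x p
      rw [hpx, dist_toLp_fin_two, Real.sqrt_eq_iff_mul_self_eq (by positivity) (by positivity)]
      ring)
    ((dist_self _).trans (dist_self _).symm)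
  rw [dist_toLp_fin_two] at key
  calc dist p z ^ 2 ≤ √((t * d - u) ^ 2 + (0 - v) ^ 2) ^ 2 := by gcongr
    _ = (t * d - u) ^ 2 + (0 - v) ^ 2 := Real.sq_sqrt (by positivity)
    _ = _ := by linear_combination hv - t * hu

/-- If `b ≤ c + r * s` for all small positive `s`, then `b ≤ c`. -/
theorem le_of_forall_le_add_mul {b c r : ℝ} (h : ∀ s, 0 < s → s ≤ 1 → b ≤ c + r * s) : b ≤ c := by
  have hlim : Tendsto (fun s : ℝ => c + r * s) (𝓝[>] 0) (𝓝 c) := by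
    have : Tendsto (fun s : ℝ => c + r * s) (𝓝 0) (𝓝 (c + r * 0)) :=
      Continuous.tendsto (by fun_prop) 0
    rw [mul_zero, add_zero] at this
    exact this.mono_left nhdsWithin_le_nhds
  refine ge_of_tendsto hlim ?_
  filter_upwards [Ioc_mem_nhdsGT (zero_lt_one' ℝ)] with s hs using h s hs.1 hs.2

/-- Weights certifying a mean of points contracted towards it certify, once multiplied by the
contraction factors, that it minimizes the weighted sum of squared distances to the original
points. -/
theorem CertifiesMemMean.sum_mul_dist_sq_le {X : Type*} [MetricSpace X] [IsCAT0Space X]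
    {ι : Type*} [Fintype ι] {pt : ι → X} {xbar : X} {t w : ι → ℝ}
    (ht : ∀ i, 0 < t i ∧ t i ≤ 1)
    (hw : CertifiesMemMean (fun i => geodesicPoint xbar (pt i) (t i)) xbar w) (x : X) :
    ∑ i, t i * w i * dist xbar (pt i) ^ 2 ≤ ∑ i, t i * w i * dist x (pt i) ^ 2 := by
  obtain ⟨⟨hw0, hw1⟩, hmin⟩ := hw
  have hT0 : 0 ≤ ∑ i, t i * w i :=
    Finset.sum_nonneg fun i _ => mul_nonneg (ht i).1.le (hw0 i)
  have hcontr : ∀ z : X, ∑ i, t i * w i * dist xbar (pt i) ^ 2 ≤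
      ∑ i, t i * w i * dist z (pt i) ^ 2 + (1 - ∑ i, t i * w i) * dist xbar z ^ 2 := by
    intro z
    have h : ∑ i, w i * (t i * dist xbar (pt i)) ^ 2 ≤
        ∑ i, w i * ((1 - t i) * dist xbar z ^ 2 + t i * dist (pt i) z ^ 2
          - t i * (1 - t i) * dist xbar (pt i) ^ 2) := by
      refine le_trans (le_of_eq ?_) ((hmin z).trans ?_)
      · refine Finset.sum_congr rfl fun i _ => ?_
        rw [(isGeodesicPoint_geodesicPoint xbar (pt i) (ht i).1.le (ht i).2).1]
      · refine Finset.sum_le_sum fun i _ => mul_le_mul_of_nonneg_left ?_ (hw0 i)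
        rw [dist_comm z]
        exact dist_geodesicPoint_sq_le _ _ _ (ht i).1.le (ht i).2
    -- Writing 1 as ∑ w_i reduces the claim to a termwise identity: the coefficients t_i² and t_i (1
    -- - t_i) of w_i d(xbar, p_i)² add up to t_i.
    rw [← hw1, sub_mul, Finset.sum_mul, Finset.sum_mul, ← Finset.sum_sub_distrib,
      ← Finset.sum_add_distrib, ← sub_nonneg, ← Finset.sum_sub_distrib]
    rw [← sub_nonneg, ← Finset.sum_sub_distrib] at h
    refine h.trans_eq (Finset.sum_congr rfl fun i _ => ?_)
    rw [dist_comm z]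
    ring
  have hlim : ∑ i, t i * w i * dist xbar (pt i) ^ 2 ≤
      ∑ i, t i * w i * dist x (pt i) ^ 2 - (∑ i, t i * w i) * dist xbar x ^ 2 := by
    -- After division by s, the terms of order s are T d(xbar, x)² from strong convexity and (1 - T)
    -- d(xbar, x)² from the error, whence the value of r.
    refine le_of_forall_le_add_mul (r := dist xbar x ^ 2) fun s hs0 hs1 => ?_
    have h := hcontr (geodesicPoint xbar x s)
    rw [(isGeodesicPoint_geodesicPoint xbar x hs0.le hs1).1] at h
    have hconv : ∑ i, t i * w i * dist (geodesicPoint xbar x s) (pt i) ^ 2 ≤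
        (1 - s) * ∑ i, t i * w i * dist xbar (pt i) ^ 2 + s * ∑ i, t i * w i * dist x (pt i) ^ 2
          - s * (1 - s) * dist xbar x ^ 2 * ∑ i, t i * w i := by
      rw [Finset.mul_sum, Finset.mul_sum, Finset.mul_sum, ← Finset.sum_add_distrib,
        ← Finset.sum_sub_distrib]
      refine Finset.sum_le_sum fun i _ => ?_
      refine (mul_le_mul_of_nonneg_left (dist_geodesicPoint_sq_le xbar x (pt i) hs0.le hs1)
        (mul_nonneg (ht i).1.le (hw0 i))).trans_eq ?_
      ring
    refine le_of_mul_le_mul_left ?_ hs0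
    linarith
  have := mul_nonneg hT0 (sq_nonneg (dist xbar x))
  linarith

/-- A point strictly closer than `xbar` to a point between `xbar` and `a` is strictly closer than
`xbar` to `a`. -/
theorem IsGeodesicPoint.dist_lt {X : Type*} [MetricSpace X] {xbar a p x : X} {t : ℝ}
    (hp : IsGeodesicPoint xbar a t p) (hx : dist x p < dist xbar p) : dist x a < dist xbar a := by
  have := dist_triangle x p a
  rw [hp.1] at hx
  rw [hp.2] at this
  linarith

/-- On the geodesic from `xbar` to a point strictly closer to `a`, every point other than `xbar` is
strictly closer to `a` than `xbar`. -/
theorem dist_geodesicPoint_lt {X : Type*} [MetricSpace X] [IsCAT0Space X] {xbar x a : X} {s : ℝ}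
    (hs0 : 0 < s) (hs1 : s ≤ 1) (hx : dist x a < dist xbar a) :
    dist (geodesicPoint xbar x s) a < dist xbar a := by
  refine lt_of_pow_lt_pow_left₀ 2 dist_nonneg ?_
  have h := dist_geodesicPoint_sq_le xbar x a hs0.le hs1
  have hsq : dist x a ^ 2 < dist xbar a ^ 2 := by gcongr
  have h1 := mul_pos hs0 (sub_pos.2 hsq)
  have h2 := mul_nonneg (mul_nonneg hs0.le (sub_nonneg.2 hs1)) (sq_nonneg (dist xbar x))
  linarith

theorem mainTheorem7 {X : Type*} [MetricSpace X] [IsHadamardSpace X] (A : Finset X) (xbar : X)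
    (hxbar : xbar ∉ A) (t : A → ℝ) (ht : ∀ a, 0 < t a ∧ t a ≤ 1) :
    (∀ w : A → ℝ,
      CertifiesMemMean (fun a : A => geodesicPoint xbar (a : X) (t a)) xbar w →
        CertifiesMemMean (fun a : A => (a : X)) xbar
          (fun a => t a * w a / ∑ b, t b * w b)) ∧
    (∀ x : X,
      CertifiesNotMemMean (Set.range fun a : A => geodesicPoint xbar (a : X) (t a)) xbar x →
        ∀ᶠ s in 𝓝[>] (0 : ℝ), CertifiesNotMemMean (A : Set X) xbar (geodesicPoint xbar x s)) := by
  constructor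
  · intro w hw
    have hw0 := hw.1.1
    -- The weights sum to 1, so one of them is positive, and every t_a is positive.
    have hpos : 0 < ∑ b, t b * w b := by
      obtain ⟨a, -, ha⟩ : ∃ a ∈ Finset.univ, 0 < w a :=
        Finset.exists_lt_of_sum_lt (by rw [hw.1.2, Finset.sum_const_zero]; exact one_pos)
      exact Finset.sum_pos' (fun b _ => mul_nonneg (ht b).1.le (hw0 b))
        ⟨a, Finset.mem_univ a, mul_pos (ht a).1 ha⟩
    refine ⟨⟨fun a => div_nonneg (mul_nonneg (ht a).1.le (hw0 a)) hpos.le, ?_⟩, fun x => ?_⟩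
    · rw [← Finset.sum_div, div_self hpos.ne']
    · simp only [div_mul_eq_mul_div, ← Finset.sum_div]
      exact div_le_div_of_nonneg_right (hw.sum_mul_dist_sq_le ht x) hpos.le
  · intro x hx
    -- Every s in (0, 1] works.
    filter_upwards [Ioc_mem_nhdsGT (zero_lt_one' ℝ)] with s hs a ha
    have hp := isGeodesicPoint_geodesicPoint xbar a (ht ⟨a, ha⟩).1.le (ht ⟨a, ha⟩).2
    exact dist_geodesicPoint_lt hs.1 hs.2 (hp.dist_lt (hx _ ⟨⟨a, ha⟩, rfl⟩))
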